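/- For a real number $x$ write $e(x)=e^{2\pi i x}$, and for a positive integer $N$ write $[N]=\{1,2,\dots,N\}$. There exist universal real constants $c_1,c_2>0$ with the following property. For every positive integer $N$ there exist a permutation $\sigma:[N]\to[N]$ and complex numbers $b_1,\dots,b_N$ with $\sum_{n=1}^N|b_n|^2=1$ such that, for every positive integer $M$, $$\left|\left\{a\in[M]:\ \max_{1\le \ell\le N}\left|\sum_{n=1}^{\ell} b_n\, e\!\left(\frac{\sigma(n)\,a}{M}\right)\right|>c_1(\log N)^{1/4}\right\}\right|\ \ge\ c_2 M .$$ (The permutation $\sigma$ and the coefficients $b_n$ depend only on $N$, not on $M$.) -/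

import Mathlib

noncomputable section

/-- The additive character `e(x) = exp(2πix)`. -/
def addExp (x : ℝ) : ℂ :=
  Complex.exp (2 * (Real.pi : ℂ) * Complex.I * (x : ℂ))

/-- The partial sum `∑_{n ≤ ℓ} b_n e(σ(n) x)`. The set `[N] = {1, …, N}` is modelled by `Fin N`,
the element `i : Fin N` standing for the integer `i + 1`. -/
def rearrangedPartialSum {N : ℕ} (σ : Equiv.Perm (Fin N)) (b : Fin N → ℂ) (x : ℝ) (l : Fin N) : ℂ :=
  ∑ n ∈ Finset.Iic l, b n * addExp ((((σ n : ℕ) + 1 : ℕ) : ℝ) * x)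

/-- The rearranged maximal function `max_{1 ≤ ℓ ≤ N} |∑_{n ≤ ℓ} b_n e(σ(n) x)|`
(a supremum over a finite set, so a maximum as soon as `N ≥ 1`). -/
def rearrangedMax {N : ℕ} (σ : Equiv.Perm (Fin N)) (b : Fin N → ℂ) (x : ℝ) : ℝ :=
  ⨆ l : Fin N, ‖rearrangedPartialSum σ b x l‖

end

/-! Attach to each node of a binary tree of depth K a trigonometric polynomial c with values in [-1,
1], mostly close to ±1, and let a unit mass descend from the root: each node sends the share (1 +
c)/2 to the right and (1 - c)/2 to the left. The block of a node is its mass times its c. The masses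
of one level add up to 1, so the blocks of a level have total energy at most 1, and those of the
tree at most K.

Where every c is nearly a sign, almost all the mass follows a single path. List the blocks in the
in-order of the tree and cut at the end u of this path: on the path, the nodes before the cut are
exactly those with c > 0. With P positive and Q negative nodes on the path, the sum S(u) up to the
cut is about P and the full sum S is about P - Q, so 2 S(u) - S is about P + Q = K, and one of the
two sums is of order K (`exists_le_inorderSum`). Dividing by the norm, at most √K, leaves order √K.

The spectra of the blocks are disjoint, so a permutation of the frequencies can list the blocks in
any order (`exists_perm_of_disjoint_spectra`). A sign with precision 2^(-K) outside a set of
proportion 2^(-K) costs degree 3^(O(K)), so each level widens the spectrum by a factor 2^(O(K)).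
Hence log N of order K² suffices, and √K is of order (log N)^(1/4).

Uniformity in M comes from a phase shift: a wave is small only if a multiple of a/M is close to √2
modulo 1. As √2 is badly approximable, this is rare for every denominator (`card_near_sqrt_two_le`).
-/

noncomputable section

/-! ### Mass distributed along a binary tree -/

/-- The mass of the node `(k, i)` when each node `(k, i)` passes the share `(1 + c k i) / 2` to its
right child `(k + 1, 2 * i + 1)` and the rest to its left child `(k + 1, 2 * i)`. -/
def treeMass (c : ℕ → ℕ → ℝ) : ℕ → ℕ → ℝ
  | 0, _ => 1
  | k + 1, j => treeMass c k (j / 2) * ((1 + (if j % 2 = 1 then c k (j / 2) else -c k (j / 2))) / 2)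

/-- The node at depth `k` on the path that turns right exactly at the nodes with `0 < c k i`. -/
def treePath (c : ℕ → ℕ → ℝ) : ℕ → ℕ
  | 0 => 0
  | k + 1 => 2 * treePath c k + if 0 < c k (treePath c k) then 1 else 0

theorem treeMass_nonneg {c : ℕ → ℕ → ℝ} (hc : ∀ k i, |c k i| ≤ 1) (k i : ℕ) :
    0 ≤ treeMass c k i := by
  induction k generalizing i with
  | zero => simp [treeMass]
  | succ k ih =>
    have h := abs_le.1 (hc k (i / 2))
    refine mul_nonneg (ih _) ?_
    split_ifs <;> linarith

theorem sum_range_two_mul (f : ℕ → ℝ) (n : ℕ) :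
    ∑ j ∈ Finset.range (2 * n), f j = ∑ i ∈ Finset.range n, (f (2 * i) + f (2 * i + 1)) := by
  induction n with
  | zero => simp
  | succ n ih =>
    rw [show 2 * (n + 1) = 2 * n + 1 + 1 by ring, Finset.sum_range_succ, Finset.sum_range_succ, ih,
      Finset.sum_range_succ, add_assoc]

theorem sum_treeMass (c : ℕ → ℕ → ℝ) (k : ℕ) :
    ∑ i ∈ Finset.range (2 ^ k), treeMass c k i = 1 := by
  induction k with
  | zero => simp [treeMass]
  | succ k ih =>
    rw [pow_succ', sum_range_two_mul, ← ih]
    refine Finset.sum_congr rfl fun i _ => ?_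
    have h1 : (2 * i + 1) / 2 = i := by omega
    have h2 : (2 * i + 1) % 2 = 1 := by omega
    simp only [treeMass, h1, h2, Nat.mul_div_cancel_left i two_pos, Nat.mul_mod_right, if_true,
      zero_ne_one, if_false]
    ring

theorem treePath_lt (c : ℕ → ℕ → ℝ) (k : ℕ) : treePath c k < 2 ^ k := by
  induction k with
  | zero => simp [treePath]
  | succ k ih =>
    rw [treePath, pow_succ]
    split_ifs <;> omega

theorem treePath_div (c : ℕ → ℕ → ℝ) (k m : ℕ) : treePath c (k + m) / 2 ^ m = treePath c k := by
  induction m with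
  | zero => simp
  | succ m ih =>
    rw [pow_succ', ← Nat.div_div_eq_div_mul, ← add_assoc, treePath, ← ih]
    congr 1
    split_ifs <;> omega

/-- The path always takes the larger share, which is at least 1 - ε/2; Bernoulli's inequality bounds
the product of the shares. -/
theorem le_treeMass_treePath {c : ℕ → ℕ → ℝ} {ε : ℝ} (hε : ε ≤ 2) (hc : ∀ k i, |c k i| ≤ 1)
    (k : ℕ) (h : ∀ l < k, ∀ i < 2 ^ l, 1 - ε ≤ |c l i|) :
    1 - k * (ε / 2) ≤ treeMass c k (treePath c k) := by
  have key : (1 - ε / 2) ^ k ≤ treeMass c k (treePath c k) := by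
    induction k with
    | zero => simp [treeMass]
    | succ k ih =>
      have h0 := h k (Nat.lt_succ_self k) _ (treePath_lt c k)
      have ih := ih fun l hl => h l (hl.trans (Nat.lt_succ_self k))
      have hd : treePath c (k + 1) / 2 = treePath c k := by
        simpa using treePath_div c k 1
      have hm : treePath c (k + 1) % 2 = 1 ↔ 0 < c k (treePath c k) := by
        rw [treePath]
        split_ifs with h <;> simp [h]
      rw [pow_succ, treeMass, hd]
      refine mul_le_mul ih ?_ (by linarith) (treeMass_nonneg hc _ _)
      by_cases hp : 0 < c k (treePath c k)
      · rw [if_pos (hm.2 hp)]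
        rw [abs_of_pos hp] at h0
        linarith
      · rw [if_neg (mt hm.1 hp)]
        rw [abs_of_nonpos (not_lt.1 hp)] at h0
        linarith
  refine le_trans ?_ key
  have := one_add_mul_le_pow (a := -(ε / 2)) (by linarith) k
  rw [← sub_eq_add_neg] at this
  linarith

/-- The sum of `f` over the nodes of depth less than `K` up to the position `u` of the in-order
traversal. -/
def inorderSum {A : Type*} [AddCommMonoid A] (K : ℕ) (f : ℕ → ℕ → A) (u : ℕ) : A :=
  ∑ k ∈ Finset.range K, ∑ i ∈ Finset.range (2 ^ k),
    if (2 * i + 1) * 2 ^ (K - 1 - k) ≤ u then f k i else 0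

theorem exists_le_inorderSum {c : ℕ → ℕ → ℝ} {ε : ℝ} {K : ℕ} (hε : 0 ≤ ε) (hK : K * ε ≤ 1 / 8)
    (hc : ∀ k i, |c k i| ≤ 1) (h : ∀ k < K, ∀ i < 2 ^ k, 1 - ε ≤ |c k i|) :
    ∃ u, (K : ℝ) / 5 ≤ |inorderSum K (fun k i => treeMass c k i * c k i) u| := by
  by_contra! hcon
  set g : ℕ → ℕ → ℝ := fun k i => treeMass c k i * c k i with hg
  set u := treePath c K with hu
  -- In 2 S(u) - S every node enters with a sign ±1. The path node gives mass · |c| ≥ (15/16)(7/8),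
  -- and the other nodes lose at most their mass, at most 1/16 in total; 3/5 is a safe lower bound.
  have hlevel : ∀ k ∈ Finset.range K, (3 / 5 : ℝ) ≤
      2 * (∑ i ∈ Finset.range (2 ^ k), if (2 * i + 1) * 2 ^ (K - 1 - k) ≤ u then g k i else 0)
        - ∑ i ∈ Finset.range (2 ^ k), if (2 * i + 1) * 2 ^ (K - 1 - k) ≤ 2 ^ K then g k i else 0 := by
    intro k hk
    have hkK := Finset.mem_range.1 hk
    have hK1 : (1 : ℝ) ≤ K := by exact_mod_cast (by omega : 1 ≤ K)
    have hε8 : ε ≤ 1 / 8 := le_trans (le_mul_of_one_le_left hε hK1) hK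
    set j := treePath c k with hj
    have hjk := treePath_lt c k
    have hmass : 1 - 1 / 16 ≤ treeMass c k j := by
      refine le_trans ?_ (le_treeMass_treePath (by linarith) hc k fun l hl => h l (hl.trans hkK))
      have : (k : ℝ) * ε ≤ K * ε :=
        mul_le_mul_of_nonneg_right (by exact_mod_cast hkK.le) hε
      linarith
    -- Dividing u by 2^(K-1-k) gives the path node at depth k + 1, which is 2j or 2j + 1 according
    -- to the turn at j.
    have hpos : (2 * j + 1) * 2 ^ (K - 1 - k) ≤ u ↔ 0 < c k j := by
      have hd := treePath_div c (k + 1) (K - 1 - k)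
      rw [show k + 1 + (K - 1 - k) = K by omega] at hd
      rw [← Nat.le_div_iff_mul_le (by positivity), hu, hd, treePath, ← hj]
      split_ifs with h <;> simp [h]
    -- All positions are at most 2^K, so the cut at 2^K gives the full sum.
    have hall : ∀ i ∈ Finset.range (2 ^ k), (2 * i + 1) * 2 ^ (K - 1 - k) ≤ 2 ^ K := by
      intro i hi
      have hi := Finset.mem_range.1 hi
      calc (2 * i + 1) * 2 ^ (K - 1 - k) ≤ 2 ^ (k + 1) * 2 ^ (K - 1 - k) :=
            Nat.mul_le_mul_right _ (by rw [pow_succ]; omega)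
        _ = 2 ^ K := by rw [← pow_add]; congr 1; omega
    rw [Finset.mul_sum, ← Finset.sum_sub_distrib]
    have hsub : ∀ i ∈ Finset.range (2 ^ k), (if i = j then (3 / 5 + 1 : ℝ) else 0) - treeMass c k i ≤
        2 * (if (2 * i + 1) * 2 ^ (K - 1 - k) ≤ u then g k i else 0) -
          (if (2 * i + 1) * 2 ^ (K - 1 - k) ≤ 2 ^ K then g k i else 0) := by
      intro i hi
      rw [if_pos (hall i hi)]
      have hm0 := treeMass_nonneg hc k i
      have hmj := treeMass_nonneg hc k j
      by_cases hij : i = j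
      · rw [if_pos hij, hij]
        have hci := h k hkK j hjk
        by_cases hp : 0 < c k j
        · rw [if_pos (hpos.2 hp)]
          rw [abs_of_pos hp] at hci
          simp only [hg]
          nlinarith
        · rw [if_neg (mt hpos.1 hp)]
          rw [abs_of_nonpos (not_lt.1 hp)] at hci
          simp only [hg]
          nlinarith
      · rw [if_neg hij]
        have := abs_le.1 (hc k i)
        split_ifs <;> simp only [hg] <;> nlinarith
    refine le_trans ?_ (Finset.sum_le_sum hsub)
    rw [Finset.sum_sub_distrib, sum_treeMass, Finset.sum_ite_eq' , if_pos (Finset.mem_range.2 hjk)]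
    norm_num
  have hsum := Finset.sum_le_sum hlevel
  rw [Finset.sum_sub_distrib, ← Finset.mul_sum, Finset.sum_const, Finset.card_range,
    nsmul_eq_mul] at hsum
  have h1 := abs_lt.1 (hcon u)
  have h2 := abs_lt.1 (hcon (2 ^ K))
  simp only [inorderSum] at h1 h2
  linarith

/-! ### A polynomial iteration converging to the sign function -/

/-- The odd cubic `(3t - t³)/2`, whose iterates converge to the sign function on `[-1, 1]`. -/
def signStep (t : ℝ) : ℝ := (3 * t - t ^ 3) / 2

theorem signStep_neg (t : ℝ) : signStep (-t) = -signStep t := by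
  simp only [signStep]; ring

theorem abs_signStep_iterate {t : ℝ} (n : ℕ) : |signStep^[n] t| = |signStep^[n] (|t|)| := by
  have hneg : signStep^[n] (-t) = -signStep^[n] t := by
    induction n with
    | zero => rfl
    | succ n ih => rw [Function.iterate_succ_apply', ih, signStep_neg,
        Function.iterate_succ_apply']
  rcases abs_choice t with h | h <;> rw [h]
  rw [hneg, abs_neg]

theorem signStep_mem {t : ℝ} (h0 : 0 ≤ t) (h1 : t ≤ 1) :
    t ≤ signStep t ∧ signStep t ≤ 1 := by
  constructor
  · simp only [signStep]
    nlinarith [mul_nonneg h0 (mul_nonneg (sub_nonneg.2 h1) (by linarith : 0 ≤ 1 + t))]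
  · simp only [signStep]
    nlinarith [mul_nonneg (sq_nonneg (1 - t)) (by linarith : 0 ≤ 2 + t)]

theorem signStep_iterate_mem {t : ℝ} (h0 : 0 ≤ t) (h1 : t ≤ 1) (n : ℕ) :
    t ≤ signStep^[n] t ∧ signStep^[n] t ≤ 1 := by
  induction n with
  | zero => exact ⟨le_rfl, h1⟩
  | succ n ih =>
    rw [Function.iterate_succ_apply']
    have := signStep_mem (h0.trans ih.1) ih.2
    exact ⟨ih.1.trans this.1, this.2⟩

theorem abs_signStep_iterate_le_one {t : ℝ} (h1 : |t| ≤ 1) (n : ℕ) : |signStep^[n] t| ≤ 1 := by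
  rw [abs_signStep_iterate]
  have := signStep_iterate_mem (abs_nonneg t) h1 n
  rw [abs_of_nonneg ((abs_nonneg t).trans this.1)]
  exact this.2

/-- Below 1/2 a step multiplies by (3 - s²)/2 ≥ 11/8; above 1/2 the values never come back down. -/
theorem min_le_signStep_iterate {t : ℝ} (h0 : 0 ≤ t) (h1 : t ≤ 1) (n : ℕ) :
    min ((11 / 8) ^ n * t) (1 / 2) ≤ signStep^[n] t := by
  induction n with
  | zero => simp
  | succ n ih =>
    have hm := signStep_iterate_mem h0 h1 n
    rw [Function.iterate_succ_apply', min_le_iff]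
    set s := signStep^[n] t
    have hs0 := h0.trans hm.1
    rcases le_total (1 / 2) s with hs | hs
    · exact Or.inr (hs.trans (signStep_mem hs0 hm.2).1)
    · rcases min_le_iff.1 ih with h | h
      · left
        have : 11 / 8 * s ≤ signStep s := by
          simp only [signStep]
          nlinarith [mul_nonneg hs0 (mul_nonneg (sub_nonneg.2 hs) (by linarith : 0 ≤ 1 / 2 + s))]
        rw [pow_succ]
        linarith
      · exact Or.inr (h.trans (signStep_mem hs0 hm.2).1)

/-- The error obeys 1 - `signStep` s = (1 - s) · (1 - s)(2 + s)/2, and the last factor is at most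
5/8 on [1/2, 1]. -/
theorem one_sub_signStep_iterate_le {t : ℝ} (h0 : 1 / 2 ≤ t) (h1 : t ≤ 1) (n : ℕ) :
    1 - signStep^[n] t ≤ (3 / 4) ^ n := by
  induction n with
  | zero => simp only [Function.iterate_zero, id, pow_zero]; linarith
  | succ n ih =>
    have hm := signStep_iterate_mem (by linarith) h1 n
    rw [Function.iterate_succ_apply', pow_succ]
    set s := signStep^[n] t
    have : 1 - signStep s ≤ 3 / 4 * (1 - s) := by
      simp only [signStep]
      nlinarith [mul_nonneg (sub_nonneg.2 hm.2)
        (by nlinarith [hm.1] : 0 ≤ 3 / 4 - (1 - s) * (2 + s) / 2)]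
    linarith

/-- After `3 p + 3 q` steps, values at distance `2⁻ᵖ` from zero are within `2⁻ᑫ` of a sign. -/
theorem one_sub_le_abs_signStep_iterate {t : ℝ} {p q : ℕ} (h1 : |t| ≤ 1) (h0 : (1 / 2) ^ p ≤ |t|) :
    1 - (1 / 2) ^ q ≤ |signStep^[3 * q + 3 * p] t| := by
  rw [abs_signStep_iterate, Function.iterate_add_apply]
  have hm := signStep_iterate_mem (abs_nonneg t) h1 (3 * p)
  have hhalf : 1 / 2 ≤ signStep^[3 * p] (|t|) := by
    refine le_trans (le_min ?_ le_rfl) (min_le_signStep_iterate (abs_nonneg t) h1 (3 * p))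
    calc (1 / 2 : ℝ) ≤ 2 ^ p * (1 / 2) ^ p := by rw [← mul_pow]; norm_num
      _ ≤ (11 / 8) ^ (3 * p) * |t| := by
        refine mul_le_mul ?_ h0 (by positivity) (by positivity)
        rw [pow_mul]
        exact pow_le_pow_left₀ (by norm_num) (by norm_num) p
  refine le_trans ?_ (le_abs_self _)
  have h2 := one_sub_signStep_iterate_le hhalf hm.2 (3 * q)
  have h3 : (3 / 4 : ℝ) ^ (3 * q) ≤ (1 / 2) ^ q := by
    rw [pow_mul]
    exact pow_le_pow_left₀ (by norm_num) (by norm_num) q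
  linarith

/-! ### Multiples of a fraction close to `√2` modulo one -/

/-- From |sin πs| ≤ 2 |cos(πs/2)| and the chord bound for the sine: a wave can be small only when
its argument is near an integer. -/
theorem abs_sub_round_le_abs_cos (s : ℝ) : |s - round s| ≤ |Real.cos (Real.pi / 2 * s)| := by
  have h1 : |Real.sin (Real.pi * s)| ≤ 2 * |Real.cos (Real.pi / 2 * s)| := by
    rw [show Real.pi * s = 2 * (Real.pi / 2 * s) by ring, Real.sin_two_mul, abs_mul, abs_mul,
      abs_two]
    nlinarith [Real.abs_sin_le_one (Real.pi / 2 * s), abs_nonneg (Real.cos (Real.pi / 2 * s))]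
  have h2 : |Real.sin (Real.pi * s)| = Real.sin (Real.pi * |s - round s|) := by
    have hr := abs_sub_round s
    rw [← abs_of_nonneg (Real.sin_nonneg_of_nonneg_of_le_pi (x := Real.pi * |s - round s|)
      (by positivity) (by nlinarith [Real.pi_pos])), ← abs_of_pos Real.pi_pos, ← abs_mul,
      abs_of_pos Real.pi_pos, ← Real.abs_sin_eq_sin_abs_of_abs_le_pi, abs_abs,
      mul_sub, mul_comm _ (round s : ℝ), Real.sin_sub_int_mul_pi, abs_mul, abs_zpow]
    · simp
    · rw [abs_mul, abs_of_pos Real.pi_pos]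
      nlinarith [Real.pi_pos]
  have h3 := Real.mul_le_sin (x := Real.pi * |s - round s|) (by positivity)
    (by nlinarith [abs_sub_round s, Real.pi_pos])
  have h4 : 2 / Real.pi * (Real.pi * |s - round s|) = 2 * |s - round s| := by
    field_simp
  linarith

/-- Bad approximability of √2: the nonzero integer v² - 2g² factors as (v - √2 g)(v + √2 g), so 1 ≤
η²g · 4g = (2ηg)². -/
theorem one_le_of_abs_sub_sqrt_two_lt {v : ℤ} {g : ℕ} {η : ℝ} (hη0 : 0 < η) (hη : η ≤ 1) (hg : 0 < g)
    (h : |(v : ℝ) - √2 * g| < η ^ 2 * g) : 1 ≤ 2 * η * g := by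
  have hne : v ^ 2 - 2 * (g : ℤ) ^ 2 ≠ 0 := by
    intro h0
    have hirr := irrational_sqrt_two
    refine hirr ⟨|(v : ℚ)| / g, ?_⟩
    have hg' : (0 : ℝ) < g := by exact_mod_cast hg
    have h1 : (v : ℝ) ^ 2 = 2 * (g : ℝ) ^ 2 := by exact_mod_cast sub_eq_zero.1 h0
    push_cast
    rw [div_eq_iff hg'.ne', ← Real.sqrt_sq hg'.le, ← Real.sqrt_mul (by norm_num), ← h1,
      Real.sqrt_sq_eq_abs]
  have h1 : (1 : ℝ) ≤ |(v : ℝ) ^ 2 - 2 * (g : ℝ) ^ 2| := by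
    exact_mod_cast Int.one_le_abs hne
  have hg' : (1 : ℝ) ≤ g := by exact_mod_cast hg
  have hs : √2 ^ 2 = 2 := Real.sq_sqrt (by norm_num)
  have hs0 : 0 ≤ √2 := Real.sqrt_nonneg 2
  have hs3 : √2 ≤ 3 / 2 := by nlinarith
  have hη2 : η ^ 2 ≤ 1 := by nlinarith
  have h2 : (v : ℝ) ^ 2 - 2 * (g : ℝ) ^ 2 = (v - √2 * g) * (v + √2 * g) := by
    linear_combination (g : ℝ) ^ 2 * hs
  have h3 : |(v : ℝ) + √2 * g| ≤ 4 * g := by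
    have := abs_lt.1 h
    rw [abs_le]
    constructor <;> nlinarith
  rw [h2, abs_mul] at h1
  have h4 : 1 ≤ (2 * η * g) ^ 2 := by
    have := mul_le_mul h.le h3 (abs_nonneg _) (by positivity)
    nlinarith
  by_contra! hlt
  have : 0 ≤ 2 * η * g := by positivity
  nlinarith

open Classical in
/-- For every denominator `M`, few of the multiples `a n / M` are close to `√2` modulo one. -/
theorem card_near_sqrt_two_le (n M : ℕ) (hM : 0 < M) {η : ℝ} (hη0 : 0 < η) (hη : η ≤ 1) :
    (((Finset.Icc 1 M).filter fun a : ℕ =>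
      ∃ m : ℤ, |(n : ℝ) * a / M - √2 - m| < η ^ 2).card : ℝ) ≤ 4 * η * M := by
  set A := (Finset.Icc 1 M).filter fun a : ℕ => ∃ m : ℤ, |(n : ℝ) * a / M - √2 - m| < η ^ 2
  rcases A.eq_empty_or_nonempty with hA | ⟨a₀, ha₀⟩
  · rw [hA]; simp only [Finset.card_empty, Nat.cast_zero]; positivity
  obtain ⟨h, hh⟩ : ∃ h, h = Nat.gcd n M := ⟨_, rfl⟩
  obtain ⟨g, hg⟩ : h ∣ M := hh ▸ Nat.gcd_dvd_right n M
  obtain ⟨n', hn'⟩ : h ∣ n := hh ▸ Nat.gcd_dvd_left n M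
  have hh0 : 0 < h := hh ▸ Nat.gcd_pos_of_pos_right n hM
  have hg0 : 0 < g := Nat.pos_of_mul_pos_left (hg ▸ hM)
  have hcop : Nat.Coprime n' g := by
    rw [hn', hg, Nat.gcd_mul_left] at hh
    exact (Nat.eq_of_mul_eq_mul_left hh0 (by rw [mul_one]; exact hh)).symm
  have hgR : (0 : ℝ) < g := by exact_mod_cast hg0
  have hhR : (0 : ℝ) < h := by exact_mod_cast hh0
  have hMR : (M : ℝ) = h * g := by exact_mod_cast hg
  have hnR : (n : ℝ) = h * n' := by exact_mod_cast hn'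
  have hex : ∀ a ∈ A, ∃ m : ℤ, |((n' * a - m * g : ℤ) : ℝ) - √2 * g| < η ^ 2 * g := by
    intro a ha
    obtain ⟨m, hm⟩ := (Finset.mem_filter.1 ha).2
    refine ⟨m, ?_⟩
    have h1 : ((n' * a - m * g : ℤ) : ℝ) - √2 * g = ((n : ℝ) * a / M - √2 - m) * g := by
      rw [hMR, hnR]
      push_cast
      field_simp
      ring
    rw [h1, abs_mul, abs_of_pos hgR]
    exact mul_lt_mul_of_pos_right hm hgR
  choose! m hm using hex
  -- A single bad multiple forces the reduced denominator g to be large, so that the rounding term +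
  -- 1 in the count of residues is absorbed by 2ηg.
  have hg1 := one_le_of_abs_sub_sqrt_two_lt hη0 hη hg0 (hm a₀ ha₀)
  set I := Finset.Icc ⌈√2 * g - η ^ 2 * g⌉ ⌊√2 * g + η ^ 2 * g⌋ with hI
  -- Since n' is invertible modulo g, the numerator determines a modulo g; the second coordinate
  -- says which of the h intervals of length g contains a.
  have hcard : A.card ≤ (I ×ˢ Finset.range h).card := by
    refine Finset.card_le_card_of_injOn (fun a => ((n' * a - m a * g : ℤ), (a - 1) / g)) ?_ ?_
    · intro a ha
      have ha' := Finset.mem_coe.1 ha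
      have h1 := abs_lt.1 (hm a ha')
      have h2 := Finset.mem_Icc.1 (Finset.mem_filter.1 ha').1
      simp only [Finset.coe_product, Set.mem_prod, Finset.mem_coe, hI, Finset.mem_Icc,
        Finset.mem_range]
      refine ⟨⟨Int.ceil_le.2 (by linarith), Int.le_floor.2 (by linarith)⟩, ?_⟩
      rw [Nat.div_lt_iff_lt_mul hg0, ← hg]
      omega
    · intro a ha b hb hab
      simp only [Prod.mk.injEq] at hab
      have ha2 := Finset.mem_Icc.1 (Finset.mem_filter.1 (Finset.mem_coe.1 ha)).1
      have hb2 := Finset.mem_Icc.1 (Finset.mem_filter.1 (Finset.mem_coe.1 hb)).1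
      have hd : (g : ℤ) ∣ n' * ((a : ℤ) - b) := ⟨m a - m b, by linear_combination hab.1⟩
      have hd2 : (g : ℤ) ∣ (a : ℤ) - b :=
        (Int.isCoprime_iff_gcd_eq_one.2 (by
          rw [Int.gcd_natCast_natCast]; exact hcop.symm)).dvd_of_dvd_mul_left hd
      have hmod : (a - 1) % g = (b - 1) % g := by
        have : (b - 1) ≡ (a - 1) [MOD g] := by
          rw [Nat.modEq_iff_dvd]
          push_cast [Nat.cast_sub ha2.1, Nat.cast_sub hb2.1]
          simpa using hd2
        exact this.symm
      have h1 := Nat.div_add_mod (a - 1) g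
      have h2 := Nat.div_add_mod (b - 1) g
      rw [hab.2, hmod] at h1
      omega
  have hIc : (I.card : ℝ) ≤ 2 * η ^ 2 * g + 1 := by
    have h1 : (I.card : ℤ) = max (⌊√2 * g + η ^ 2 * g⌋ + 1 - ⌈√2 * g - η ^ 2 * g⌉) 0 := by
      rw [hI, Int.card_Icc, Int.toNat_eq_max]
    have h2 : (I.card : ℝ) =
        max ((⌊√2 * g + η ^ 2 * g⌋ : ℝ) + 1 - ⌈√2 * g - η ^ 2 * g⌉) 0 := by
      exact_mod_cast congrArg (Int.cast : ℤ → ℝ) h1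
    rw [h2]
    refine max_le ?_ (by positivity)
    have := Int.floor_le (√2 * g + η ^ 2 * g)
    have := Int.le_ceil (√2 * g - η ^ 2 * g)
    linarith
  calc (A.card : ℝ) ≤ (I.card : ℝ) * h := by
        rw [Finset.card_product, Finset.card_range] at hcard
        exact_mod_cast hcard
    _ ≤ (2 * η ^ 2 * g + 1) * h := mul_le_mul_of_nonneg_right hIc hhR.le
    _ ≤ (2 * η * g + 2 * η * g) * h := by
        refine mul_le_mul_of_nonneg_right (add_le_add ?_ hg1) hhR.le
        nlinarith [mul_pos hη0 hgR]
    _ = 4 * η * M := by rw [hMR]; ring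

open MeasureTheory

/-! ### Trigonometric polynomials with prescribed spectrum -/

/-- The exponential `x ↦ e(zx)` of integer frequency `z`. -/
def expFun (z : ℤ) : ℝ → ℂ := fun x => addExp (z * x)

/-- The trigonometric polynomials whose frequencies lie in `S`. -/
def trigSpan (S : Set ℤ) : Submodule ℂ (ℝ → ℂ) := Submodule.span ℂ (expFun '' S)

theorem addExp_add (x y : ℝ) : addExp (x + y) = addExp x * addExp y := by
  simp only [addExp, ← Complex.exp_add]
  push_cast
  ring_nf

theorem norm_addExp (x : ℝ) : ‖addExp x‖ = 1 := by
  rw [addExp, show 2 * (Real.pi : ℂ) * Complex.I * (x : ℂ) = ((2 * Real.pi * x : ℝ) : ℂ) * Complex.I by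
    push_cast; ring, Complex.norm_exp_ofReal_mul_I]

theorem continuous_addExp : Continuous addExp := by
  unfold addExp; fun_prop

theorem continuous_expFun (z : ℤ) : Continuous (expFun z) :=
  continuous_addExp.comp (by fun_prop)

theorem expFun_add (a b : ℤ) : expFun (a + b) = expFun a * expFun b := by
  funext x
  simp only [expFun, Pi.mul_apply, ← addExp_add]
  push_cast
  ring_nf

theorem expFun_zero : expFun 0 = 1 := by
  funext x
  simp [expFun, addExp]

theorem trigSpan_mono {S T : Set ℤ} (h : S ⊆ T) : trigSpan S ≤ trigSpan T :=
  Submodule.span_mono (Set.image_mono h)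

theorem mul_mem_trigSpan {S T U : Set ℤ} {f g : ℝ → ℂ} (hf : f ∈ trigSpan S) (hg : g ∈ trigSpan T)
    (h : ∀ a ∈ S, ∀ b ∈ T, a + b ∈ U) : f * g ∈ trigSpan U := by
  have := Submodule.mul_mem_mul hf hg
  rw [trigSpan, trigSpan, Submodule.span_mul_span] at this
  refine Submodule.span_mono ?_ this
  rintro _ ⟨_, ⟨a, ha, rfl⟩, _, ⟨b, hb, rfl⟩, rfl⟩
  exact ⟨a + b, h a ha b hb, expFun_add a b⟩

theorem one_mem_trigSpan {S : Set ℤ} (h : (0 : ℤ) ∈ S) : (1 : ℝ → ℂ) ∈ trigSpan S :=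
  Submodule.subset_span ⟨0, h, expFun_zero⟩

theorem exists_coeff_of_mem_trigSpan {S : Set ℤ} {f : ℝ → ℂ} (hf : f ∈ trigSpan S) :
    ∃ F : ℤ →₀ ℂ, (∀ z, F z ≠ 0 → z ∈ S) ∧ ∀ x, f x = ∑ z ∈ F.support, F z * expFun z x := by
  obtain ⟨F, hF, rfl⟩ := (Finsupp.mem_span_image_iff_linearCombination ℂ).1 hf
  refine ⟨F, fun z hz => hF (Finsupp.mem_support_iff.2 hz), fun x => ?_⟩
  simp [Finsupp.linearCombination_apply, Finsupp.sum]

theorem continuous_of_mem_trigSpan {S : Set ℤ} {f : ℝ → ℂ} (hf : f ∈ trigSpan S) : Continuous f := by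
  obtain ⟨F, -, h⟩ := exists_coeff_of_mem_trigSpan hf
  rw [funext h]
  exact continuous_finsetSum _ fun z _ => continuous_const.mul (continuous_expFun z)

theorem integral_expFun (z : ℤ) : ∫ x in (0 : ℝ)..1, expFun z x = if z = 0 then 1 else 0 := by
  split_ifs with hz
  · subst hz
    rw [expFun_zero]
    simp
  · have hc : (2 * (Real.pi : ℂ) * Complex.I * z) ≠ 0 := by
      simp [Real.pi_ne_zero, Complex.I_ne_zero, hz]
    have h := integral_exp_mul_complex (a := 0) (b := 1) hc
    have h1 : Complex.exp (2 * (Real.pi : ℂ) * Complex.I * z) = 1 :=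
      Complex.exp_eq_one_iff.2 ⟨z, by ring⟩
    simp only [Complex.ofReal_one, mul_one, h1, Complex.ofReal_zero, mul_zero, Complex.exp_zero,
      sub_self, zero_div] at h
    rw [← h]
    congr 1
    funext x
    simp only [expFun, addExp]
    push_cast
    ring_nf

theorem conj_expFun (z : ℤ) (x : ℝ) : (starRingEnd ℂ) (expFun z x) = expFun (-z) x := by
  simp only [expFun, addExp, ← Complex.exp_conj]
  congr 1
  simp only [map_mul, Complex.conj_ofReal, Complex.conj_I, map_ofNat]
  push_cast
  ring

/-- Parseval's identity for trigonometric polynomials. -/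
theorem integral_norm_sq_trig (s : Finset ℤ) (F : ℤ → ℂ) :
    ∫ x in (0 : ℝ)..1, ‖∑ z ∈ s, F z * expFun z x‖ ^ 2 = ∑ z ∈ s, ‖F z‖ ^ 2 := by
  have hpt : ∀ x : ℝ, ((‖∑ z ∈ s, F z * expFun z x‖ ^ 2 : ℝ) : ℂ) =
      ∑ z ∈ s, ∑ w ∈ s, F z * (starRingEnd ℂ) (F w) * expFun (z - w) x := by
    intro x
    push_cast
    rw [← Complex.mul_conj', map_sum, Finset.sum_mul_sum]
    refine Finset.sum_congr rfl fun z _ => Finset.sum_congr rfl fun w _ => ?_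
    rw [map_mul, conj_expFun, sub_eq_add_neg, expFun_add, Pi.mul_apply]
    ring
  have hint : ∀ (a : ℂ) (z : ℤ), IntervalIntegrable (fun x => a * expFun z x) volume 0 1 :=
    fun a z => (continuous_const.mul (continuous_expFun z)).intervalIntegrable _ _
  apply Complex.ofReal_injective
  rw [← intervalIntegral.integral_ofReal]
  simp only [hpt]
  have hint' : ∀ z ∈ s, IntervalIntegrable
      (fun x => ∑ w ∈ s, F z * (starRingEnd ℂ) (F w) * expFun (z - w) x) volume 0 1 := fun z _ =>
    (continuous_finsetSum _ fun w _ =>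
      continuous_const.mul (continuous_expFun _)).intervalIntegrable _ _
  rw [intervalIntegral.integral_finsetSum hint']
  push_cast
  refine Finset.sum_congr rfl fun z hz => ?_
  rw [intervalIntegral.integral_finsetSum fun w _ => hint _ _]
  simp only [intervalIntegral.integral_const_mul, integral_expFun, sub_eq_zero]
  simp only [mul_ite, mul_one, mul_zero]
  rw [Finset.sum_ite_eq, if_pos hz, Complex.mul_conj']

/-! ### Rearranging blocks with disjoint spectra -/

theorem norm_rearrangedPartialSum_le {N : ℕ} (σ : Equiv.Perm (Fin N)) (b : Fin N → ℂ) (x : ℝ)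
    (l : Fin N) : ‖rearrangedPartialSum σ b x l‖ ≤ rearrangedMax σ b x :=
  le_ciSup (f := fun l => ‖rearrangedPartialSum σ b x l‖) (Set.finite_range _).bddAbove l

theorem rearrangedMax_smul {N : ℕ} (σ : Equiv.Perm (Fin N)) (b : Fin N → ℂ) (x : ℝ) {r : ℝ}
    (hr : 0 ≤ r) : rearrangedMax σ (fun n => r * b n) x = r * rearrangedMax σ b x := by
  rw [rearrangedMax, rearrangedMax, Real.mul_iSup_of_nonneg hr]
  congr 1
  funext l
  simp only [rearrangedPartialSum, mul_assoc, ← Finset.mul_sum, norm_mul, Complex.norm_real,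
    Real.norm_of_nonneg hr]

/-- Sorting the frequencies by a key makes every sum over an initial range of keys a partial sum. -/
theorem norm_sum_key_le_rearrangedMax {N : ℕ} (κ : Fin N → ℕ) (c : Fin N → ℂ) (x : ℝ)
    (u : ℕ) : ‖∑ j with κ j ≤ u, c j * addExp (((j : ℕ) + 1 : ℕ) * x)‖ ≤
      rearrangedMax (Tuple.sort κ) (c ∘ Tuple.sort κ) x := by
  set σ := Tuple.sort κ
  have hmono : Monotone (κ ∘ σ) := Tuple.monotone_sort κ
  have hre : ∑ j with κ j ≤ u, c j * addExp (((j : ℕ) + 1 : ℕ) * x) =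
      ∑ n with κ (σ n) ≤ u, (c ∘ σ) n * addExp (((σ n : ℕ) + 1 : ℕ) * x) := by
    rw [Finset.sum_filter, Finset.sum_filter, ← Equiv.sum_comp σ]
    rfl
  rw [hre]
  rcases (Finset.univ.filter fun n => κ (σ n) ≤ u).eq_empty_or_nonempty with h | h
  · rw [h, Finset.sum_empty, norm_zero]
    exact Real.iSup_nonneg fun _ => norm_nonneg _
  · obtain ⟨l, hl, hmax⟩ := Finset.exists_max_image _ id h
    have : (Finset.univ.filter fun n => κ (σ n) ≤ u) = Finset.Iic l := by
      ext n
      simp only [Finset.mem_filter, Finset.mem_univ, true_and, Finset.mem_Iic]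
      refine ⟨fun hn => hmax n (by simpa using hn), fun hn => ?_⟩
      exact (hmono hn).trans (Finset.mem_filter.1 hl).2
    rw [this]
    exact norm_rearrangedPartialSum_le σ _ x l

/-- Trigonometric polynomials with disjoint spectra in `[-H, H]` can be laid out, in the order of
prescribed keys, as blocks of one rearranged sum. -/
theorem exists_perm_of_disjoint_spectra {ι : Type*} (s : Finset ι) (f : ι → ℝ → ℂ)
    (Z : ι → Set ℤ) (key : ι → ℕ) {H N : ℕ} (hN : 2 * H + 1 ≤ N)
    (hf : ∀ a ∈ s, f a ∈ trigSpan (Z a)) (hH : ∀ a ∈ s, ∀ z ∈ Z a, |z| ≤ H)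
    (hZ : ∀ a ∈ s, ∀ b ∈ s, ∀ z, z ∈ Z a → z ∈ Z b → a = b) :
    ∃ (σ : Equiv.Perm (Fin N)) (c : Fin N → ℂ),
      ∑ n, ‖c n‖ ^ 2 = ∑ a ∈ s, ∫ x in (0 : ℝ)..1, ‖f a x‖ ^ 2 ∧
      ∀ x u, ‖∑ a ∈ s with key a ≤ u, f a x‖ ≤ rearrangedMax σ c x := by
  classical
  choose! F hFZ hFsum using fun a ha => exists_coeff_of_mem_trigSpan (hf a ha)
  have hsum : ∀ a ∈ s, ∀ (M : Type) [AddCommMonoid M] (G : ℤ → M), (∀ z, F a z = 0 → G z = 0) →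
      ∑ z ∈ (F a).support, G z = ∑ j : Fin N, G ((j : ℤ) - H) := by
    intro a ha M _ G hG
    have hinj : Function.Injective fun j : Fin N => (j : ℤ) - H := by
      intro i j hij
      simp only [sub_left_inj, Nat.cast_inj] at hij
      exact Fin.ext hij
    rw [← Finset.sum_image (s := Finset.univ) (g := fun j : Fin N => (j : ℤ) - H) (f := G)
      fun i _ j _ h => hinj h]
    refine Finset.sum_subset ?_ fun z _ hz => hG z (by simpa using hz)
    intro z hz
    have h1 := abs_le.1 (hH a ha z (hFZ a ha z (Finsupp.mem_support_iff.1 hz)))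
    rw [Finset.mem_image]
    exact ⟨⟨(z + H).toNat, by omega⟩, Finset.mem_univ _, by simp only; omega⟩
  -- Disjointness gives each frequency a single key. Frequencies in no spectrum get key 0, which is
  -- harmless as their coefficients vanish.
  have hκ : ∀ z : ℤ, ∃ κ : ℕ, ∀ a ∈ s, z ∈ Z a → key a = κ := by
    intro z
    by_cases h : ∃ a ∈ s, z ∈ Z a
    · obtain ⟨a, ha, hz⟩ := h
      exact ⟨key a, fun b hb hzb => by rw [hZ b hb a ha z hzb hz]⟩
    · push Not at h
      exact ⟨0, fun a ha hz => absurd hz (h a ha)⟩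
  choose κ hκ using hκ
  set c : Fin N → ℂ := fun j => ∑ a ∈ s, F a ((j : ℤ) - H) with hc
  set κ' : Fin N → ℕ := fun j => κ ((j : ℤ) - H) with hκ'
  refine ⟨Tuple.sort κ', c ∘ Tuple.sort κ', ?_, fun x u => ?_⟩
  · have h1 : ∑ n, ‖(c ∘ Tuple.sort κ') n‖ ^ 2 = ∑ n, ‖c n‖ ^ 2 :=
      Equiv.sum_comp (Tuple.sort κ') fun n => ‖c n‖ ^ 2
    have h2 : ∀ j : Fin N, ‖c j‖ ^ 2 = ∑ a ∈ s, ‖F a ((j : ℤ) - H)‖ ^ 2 := by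
      intro j
      by_cases h : ∃ a ∈ s, F a ((j : ℤ) - H) ≠ 0
      · obtain ⟨a, ha, hz⟩ := h
        have h0 : ∀ b ∈ s, b ≠ a → F b ((j : ℤ) - H) = 0 := by
          intro b hb hba
          by_contra hne
          exact hba (hZ b hb a ha _ (hFZ b hb _ hne) (hFZ a ha _ hz))
        simp only [hc]
        rw [Finset.sum_eq_single_of_mem a ha h0, Finset.sum_eq_single_of_mem a ha]
        intro b hb hba
        rw [h0 b hb hba]
        simp
      · push Not at h
        simp only [hc]
        rw [Finset.sum_eq_zero h, Finset.sum_eq_zero fun a ha => by rw [h a ha]; simp]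
        simp
    rw [h1, Finset.sum_congr rfl fun j _ => h2 j, Finset.sum_comm]
    refine Finset.sum_congr rfl fun a ha => ?_
    simp only [hFsum a ha]
    rw [integral_norm_sq_trig, hsum a ha ℝ (fun z => ‖F a z‖ ^ 2) fun z hz => by simp [hz]]
  · refine le_trans (le_of_eq ?_) (norm_sum_key_le_rearrangedMax κ' c x u)
    -- The index j carries the frequency j - H but is evaluated at j + 1; the translation by H + 1
    -- is a factor of modulus one.
    have h1 : ∑ j with κ' j ≤ u, c j * addExp (((j : ℕ) + 1 : ℕ) * x) =
        addExp ((H + 1) * x) * ∑ a ∈ s with key a ≤ u, f a x := by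
      rw [Finset.sum_filter, Finset.mul_sum, Finset.sum_filter]
      have h2 : ∀ a ∈ s, (if key a ≤ u then addExp ((H + 1) * x) * f a x else 0) =
          ∑ j : Fin N, if κ' j ≤ u then
            F a ((j : ℤ) - H) * addExp (((j : ℕ) + 1 : ℕ) * x) else 0 := by
        intro a ha
        have h3 : ∀ j : Fin N, (if κ' j ≤ u then
            F a ((j : ℤ) - H) * addExp (((j : ℕ) + 1 : ℕ) * x) else 0) =
            if key a ≤ u then addExp ((H + 1) * x) *
              (F a ((j : ℤ) - H) * expFun ((j : ℤ) - H) x) else 0 := by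
          intro j
          by_cases hz : F a ((j : ℤ) - H) = 0
          · simp [hz]
          · rw [hκ _ a ha (hFZ a ha _ hz)]
            refine if_congr Iff.rfl ?_ rfl
            rw [mul_left_comm, expFun, ← addExp_add]
            congr 2
            push_cast
            ring
        rw [Finset.sum_congr rfl fun j _ => h3 j]
        split_ifs
        · rw [← Finset.mul_sum, hFsum a ha,
            hsum a ha ℂ (fun z => F a z * expFun z x) fun z hz => by simp [hz]]
        · simp
      rw [Finset.sum_congr rfl h2, Finset.sum_comm]
      refine Finset.sum_congr rfl fun j _ => ?_
      simp only [hc, Finset.sum_mul]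
      split_ifs <;> simp
    rw [h1, norm_mul, norm_addExp, one_mul]

/-! ### Waves close to a sign -/

/-- A trigonometric polynomial close to the sign of a shifted cosine of frequency `n`. -/
def signWave (J n : ℕ) (x : ℝ) : ℝ :=
  signStep^[J] (Real.cos (Real.pi / 2 * (4 * n * x - √2)))

theorem abs_signWave_le_one (J n : ℕ) (x : ℝ) : |signWave J n x| ≤ 1 :=
  abs_signStep_iterate_le_one (Real.abs_cos_le_one _) J

/-- The multiples `n d` with `d` odd and `|d| ≤ D`. -/
def oddMultiples (n D : ℕ) : Set ℤ := {z | ∃ d : ℤ, Odd d ∧ |d| ≤ D ∧ z = n * d}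

/-- Each cubic step triples the degree, and its oddness keeps the multiples odd. In particular the
multiple 0 never occurs, which the separation of spectra needs. -/
theorem signWave_mem_trigSpan (J n : ℕ) :
    (fun x => (signWave J n x : ℂ)) ∈ trigSpan (oddMultiples n (3 ^ J)) := by
  induction J with
  | zero =>
    have h : (fun x => (signWave 0 n x : ℂ)) =
        (Complex.exp (-(Real.pi / 2 * √2 : ℝ) * Complex.I) / 2) • expFun n +
        (Complex.exp ((Real.pi / 2 * √2 : ℝ) * Complex.I) / 2) • expFun (-n) := by
      funext x
      simp only [signWave, Function.iterate_zero, id, Complex.ofReal_cos, Complex.cos,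
        Pi.add_apply, Pi.smul_apply, smul_eq_mul, expFun, addExp, div_mul_eq_mul_div,
        ← Complex.exp_add, ← add_div]
      push_cast
      congr 3 <;> ring
    rw [h]
    refine Submodule.add_mem _ (Submodule.smul_mem _ _ (Submodule.subset_span ⟨_, ?_, rfl⟩))
      (Submodule.smul_mem _ _ (Submodule.subset_span ⟨_, ?_, rfl⟩))
    · exact ⟨1, odd_one, by simp, by simp⟩
    · exact ⟨-1, by decide, by simp, by simp⟩
  | succ J ih =>
    set w : ℝ → ℂ := fun x => (signWave J n x : ℂ) with hw
    have h : (fun x => (signWave (J + 1) n x : ℂ)) =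
        (3 / 2 : ℂ) • w - (1 / 2 : ℂ) • (w * w * w) := by
      funext x
      simp only [signWave, Function.iterate_succ_apply', hw, Pi.sub_apply, Pi.smul_apply,
        Pi.mul_apply, smul_eq_mul]
      rw [signStep]
      push_cast
      ring
    have hpow : ((3 ^ (J + 1) : ℕ) : ℤ) = 3 * (3 ^ J : ℕ) := by push_cast; ring
    rw [h]
    refine Submodule.sub_mem _ (Submodule.smul_mem _ _ (trigSpan_mono ?_ ih))
      (Submodule.smul_mem _ _ (mul_mem_trigSpan (S := {z | ∃ d : ℤ, Even d ∧
        |d| ≤ 2 * (3 ^ J : ℕ) ∧ z = n * d}) (mul_mem_trigSpan ih ih ?_) ih ?_))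
    · rintro z ⟨d, hd, hdD, rfl⟩
      exact ⟨d, hd, by rw [hpow]; linarith [abs_nonneg d], rfl⟩
    · rintro _ ⟨d, hd, hdD, rfl⟩ _ ⟨e, he, heD, rfl⟩
      exact ⟨d + e, hd.add_odd he, by linarith [abs_add_le d e], by ring⟩
    · rintro _ ⟨d, hd, hdD, rfl⟩ _ ⟨e, he, heD, rfl⟩
      exact ⟨d + e, hd.add_odd he, by rw [hpow]; linarith [abs_add_le d e], by ring⟩

/-! ### The tree of waves -/

/-- The frequency attached to the node `(k, i)`. -/
def nodeFreq (B T k i : ℕ) : ℕ := 3 * B ^ k * (T + i)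

/-- The wave attached to the node `(k, i)`, at the point `x`. -/
def nodeWave (J B T : ℕ) (x : ℝ) (k i : ℕ) : ℝ := signWave J (nodeFreq B T k i) x

/-- The wave of the node `(k, i)` weighted by the mass of the node. -/
def nodeBlock (J B T : ℕ) (k i : ℕ) (x : ℝ) : ℝ :=
  treeMass (nodeWave J B T x) k i * nodeWave J B T x k i

/-- The spectrum of the block of the node `(k, i)`. -/
def nodeSpec (J B T k i : ℕ) : Set ℤ :=
  {z | ∃ d r : ℤ, Odd d ∧ |d| ≤ 3 ^ J ∧ |r| ≤ B ^ k ∧ z = nodeFreq B T k i * d + r}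

theorem abs_mul_le_width {J T K W i : ℕ} (hW : (T + 2 ^ K) * 3 ^ J ≤ W) (hi : i < 2 ^ K) {d : ℤ}
    (hd : |d| ≤ 3 ^ J) : |((T : ℤ) + i) * d| ≤ W := by
  have h1 : |((T : ℤ) + i)| ≤ T + 2 ^ K := by
    rw [abs_of_nonneg (by positivity)]
    have : (i : ℤ) < 2 ^ K := by exact_mod_cast hi
    linarith
  rw [abs_mul]
  refine le_trans (mul_le_mul h1 hd (abs_nonneg _) (by positivity)) ?_
  exact_mod_cast hW

/-- Passing from level k to k + 1 multiplies by a factor with frequencies up to 3 B^k W, and B^k (1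
+ 3W) ≤ B^(k+1). -/
theorem treeMass_mem_trigSpan {J B T K W : ℕ} (hW : (T + 2 ^ K) * 3 ^ J ≤ W) (hB : 1 + 3 * W ≤ B)
    (k i : ℕ) (hk : k ≤ K) (hi : i < 2 ^ k) :
    (fun x => (treeMass (nodeWave J B T x) k i : ℂ)) ∈ trigSpan {z | |z| ≤ (B : ℤ) ^ k} := by
  induction k generalizing i with
  | zero =>
    simp only [treeMass, Complex.ofReal_one]
    exact one_mem_trigSpan (by simp)
  | succ k ih =>
    have hi' : i / 2 < 2 ^ k := by rw [pow_succ] at hi; omega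
    have ih := ih (i / 2) (by omega) hi'
    have hiK : i / 2 < 2 ^ K := hi'.trans_le (Nat.pow_le_pow_right two_pos (by omega))
    set S : Set ℤ := {z | |z| ≤ 3 * (B : ℤ) ^ k * W} with hS
    have hw : (fun x => (nodeWave J B T x k (i / 2) : ℂ)) ∈ trigSpan S := by
      refine trigSpan_mono ?_ (signWave_mem_trigSpan J (nodeFreq B T k (i / 2)))
      rintro z ⟨d, -, hd, rfl⟩
      have h := abs_mul_le_width hW hiK (d := d) (by exact_mod_cast hd)
      simp only [hS, Set.mem_ofPred_eq, nodeFreq]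
      push_cast at h ⊢
      rw [mul_assoc, abs_mul, abs_of_nonneg (by positivity : (0 : ℤ) ≤ 3 * (B : ℤ) ^ k)]
      exact mul_le_mul_of_nonneg_left h (by positivity)
    have h1 : (1 : ℝ → ℂ) ∈ trigSpan S := one_mem_trigSpan (by simp [hS]; positivity)
    have hfac : (fun x => (((1 + (if i % 2 = 1 then nodeWave J B T x k (i / 2)
        else -nodeWave J B T x k (i / 2))) / 2 : ℝ) : ℂ)) ∈ trigSpan S := by
      split_ifs
      · convert Submodule.smul_mem _ (1 / 2 : ℂ) (Submodule.add_mem _ h1 hw) using 1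
        funext x
        simp only [Pi.smul_apply, Pi.add_apply, Pi.one_apply, smul_eq_mul]
        push_cast
        ring
      · convert Submodule.smul_mem _ (1 / 2 : ℂ) (Submodule.sub_mem _ h1 hw) using 1
        funext x
        simp only [Pi.smul_apply, Pi.sub_apply, Pi.one_apply, smul_eq_mul]
        push_cast
        ring
    convert mul_mem_trigSpan (U := {z | |z| ≤ (B : ℤ) ^ (k + 1)}) ih hfac ?_ using 1
    · funext x
      rw [Pi.mul_apply, ← Complex.ofReal_mul, treeMass]
    · intro a ha b hb
      simp only [Set.mem_ofPred_eq, hS] at ha hb ⊢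
      have hB' : (1 : ℤ) + 3 * W ≤ B := by exact_mod_cast hB
      calc |a + b| ≤ (B : ℤ) ^ k + 3 * (B : ℤ) ^ k * W := by linarith [abs_add_le a b]
        _ = (B : ℤ) ^ k * (1 + 3 * W) := by ring
        _ ≤ (B : ℤ) ^ (k + 1) := by
          rw [pow_succ]
          exact mul_le_mul_of_nonneg_left hB' (by positivity)

theorem nodeBlock_mem_trigSpan {J B T K W : ℕ} (hW : (T + 2 ^ K) * 3 ^ J ≤ W)
    (hB : 1 + 3 * W ≤ B) (k i : ℕ) (hk : k ≤ K) (hi : i < 2 ^ k) :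
    (fun x => (nodeBlock J B T k i x : ℂ)) ∈ trigSpan (nodeSpec J B T k i) := by
  convert mul_mem_trigSpan (U := nodeSpec J B T k i) (treeMass_mem_trigSpan hW hB k i hk hi)
    (signWave_mem_trigSpan J (nodeFreq B T k i)) ?_ using 1
  · funext x
    rw [Pi.mul_apply, ← Complex.ofReal_mul, nodeBlock, nodeWave]
  · rintro r hr _ ⟨d, hd, hdD, rfl⟩
    exact ⟨d, r, hd, by exact_mod_cast hdD, hr, by ring⟩

theorem abs_mem_nodeSpec {J B T K W k i : ℕ} (hT : 0 < T) (hW : (T + 2 ^ K) * 3 ^ J ≤ W)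
    (hB : 1 + 3 * W ≤ B) (hi : i < 2 ^ K) {z : ℤ} (hz : z ∈ nodeSpec J B T k i) :
    2 * (B : ℤ) ^ k ≤ |z| ∧ |z| ≤ (B : ℤ) ^ (k + 1) := by
  obtain ⟨d, r, hd, hdD, hr, rfl⟩ := hz
  have h1 := abs_mul_le_width hW hi hdD
  have h2 : 1 ≤ |((T : ℤ) + i) * d| := by
    refine Int.one_le_abs (mul_ne_zero (by positivity) ?_)
    rintro rfl
    simp at hd
  have hB' : (1 : ℤ) + 3 * W ≤ B := by exact_mod_cast hB
  have hP : (0 : ℤ) ≤ (B : ℤ) ^ k := by positivity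
  have h3 : |(nodeFreq B T k i : ℤ) * d| = 3 * (B : ℤ) ^ k * |((T : ℤ) + i) * d| := by
    rw [nodeFreq]
    push_cast
    rw [mul_assoc, abs_mul, abs_of_nonneg (by positivity : (0 : ℤ) ≤ 3 * (B : ℤ) ^ k)]
  have h4 := abs_add_le ((nodeFreq B T k i : ℤ) * d) r
  have h5 := abs_sub_abs_le_abs_sub ((nodeFreq B T k i : ℤ) * d) (-r)
  rw [abs_neg, sub_neg_eq_add] at h5
  rw [h3] at h4 h5
  constructor
  · nlinarith
  · rw [pow_succ]
    nlinarith

/-- Different levels occupy separate ranges of |z|. Within a level, the factor 3 B^k exceeds the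
spread 2 B^k of the remainders, so (T + i)d = (T + i')d'; as T is large this forces d = d', and d ≠
0 gives i = i'. -/
theorem nodeSpec_disjoint {J B T K W : ℕ} (hT : 2 * 2 ^ K * 3 ^ J < T)
    (hW : (T + 2 ^ K) * 3 ^ J ≤ W) (hB : 1 + 3 * W ≤ B) {k i k' i' : ℕ} (hi : i < 2 ^ K)
    (hi' : i' < 2 ^ K) {z : ℤ} (hz : z ∈ nodeSpec J B T k i) (hz' : z ∈ nodeSpec J B T k' i') :
    k = k' ∧ i = i' := by
  have hB0 : 1 ≤ (B : ℤ) := by exact_mod_cast (by omega : 1 ≤ B)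
  have hdepth : ∀ {l l' j j' : ℕ}, j < 2 ^ K → j' < 2 ^ K → z ∈ nodeSpec J B T l j →
      z ∈ nodeSpec J B T l' j' → l' ≤ l := by
    intro l l' j j' hj hj' h h'
    by_contra! hlt
    have h1 := (abs_mem_nodeSpec (by omega) hW hB hj h).2
    have h2 := (abs_mem_nodeSpec (by omega) hW hB hj' h').1
    have h3 : (B : ℤ) ^ (l + 1) ≤ (B : ℤ) ^ l' := pow_le_pow_right₀ hB0 hlt
    have h4 : 0 < (B : ℤ) ^ l' := by positivity
    linarith
  obtain rfl : k = k' := le_antisymm (hdepth hi' hi hz' hz) (hdepth hi hi' hz hz')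
  refine ⟨rfl, ?_⟩
  obtain ⟨d, r, hd, hdD, hr, rfl⟩ := hz
  obtain ⟨d', r', -, hdD', hr', heq⟩ := hz'
  simp only [nodeFreq] at heq
  push_cast at heq
  have hP : 0 < (B : ℤ) ^ k := by positivity
  have hr2 := abs_le.1 hr
  have hr2' := abs_le.1 hr'
  have hq : 3 * (B : ℤ) ^ k * (((T : ℤ) + i) * d - ((T : ℤ) + i') * d') = r' - r := by
    linear_combination heq
  have hpp : ((T : ℤ) + i) * d = ((T : ℤ) + i') * d' := by
    rcases lt_trichotomy (((T : ℤ) + i) * d - ((T : ℤ) + i') * d') 0 with h | h | h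
    · nlinarith
    · linarith
    · nlinarith
  have hTd : (T : ℤ) * (d - d') = i' * d' - i * d := by linear_combination hpp
  have hle : |(i' : ℤ) * d' - i * d| < T := by
    have h1 : ∀ (a : ℕ) (e : ℤ), a < 2 ^ K → |e| ≤ 3 ^ J → |(a : ℤ) * e| ≤ 2 ^ K * 3 ^ J := by
      intro a e ha he
      rw [abs_mul, Nat.abs_cast]
      exact mul_le_mul (by exact_mod_cast ha.le) he (abs_nonneg _) (by positivity)
    have h2 : (2 * 2 ^ K * 3 ^ J : ℤ) < T := by exact_mod_cast hT
    have h3 := abs_sub ((i' : ℤ) * d') (i * d)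
    linarith [h1 i' d' hi' hdD', h1 i d hi hdD]
  have hdd : d = d' := by
    by_contra hne
    have h1 := Int.one_le_abs (sub_ne_zero.2 hne)
    rw [← hTd, abs_mul, Nat.abs_cast] at hle
    nlinarith
  subst hdd
  have hd0 : d ≠ 0 := by
    rintro rfl
    simp at hd
  have := mul_right_cancel₀ hd0 hpp
  omega

/-- Pointwise, (mass · c)² ≤ mass because both factors have modulus at most 1, and the masses of a
level sum to 1. -/
theorem sum_integral_nodeBlock_le {J B T K W : ℕ} (hW : (T + 2 ^ K) * 3 ^ J ≤ W)
    (hB : 1 + 3 * W ≤ B) :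
    ∑ k ∈ Finset.range K, ∑ i ∈ Finset.range (2 ^ k),
      ∫ x in (0 : ℝ)..1, ‖(nodeBlock J B T k i x : ℂ)‖ ^ 2 ≤ K := by
  have hcont : ∀ k ∈ Finset.range K, ∀ i ∈ Finset.range (2 ^ k),
      Continuous fun x => ‖(nodeBlock J B T k i x : ℂ)‖ ^ 2 := fun k hk i hi =>
    ((continuous_of_mem_trigSpan (nodeBlock_mem_trigSpan hW hB k i
      (Finset.mem_range.1 hk).le (Finset.mem_range.1 hi))).norm.pow 2)
  have hlevel : ∀ k ∈ Finset.range K, ∑ i ∈ Finset.range (2 ^ k),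
      ∫ x in (0 : ℝ)..1, ‖(nodeBlock J B T k i x : ℂ)‖ ^ 2 ≤ 1 := by
    intro k hk
    rw [← intervalIntegral.integral_finsetSum fun i hi => (hcont k hk i hi).intervalIntegrable _ _]
    have h1 : ∫ _ in (0 : ℝ)..1, (1 : ℝ) = 1 := by simp
    refine le_of_le_of_eq (intervalIntegral.integral_mono_on zero_le_one
      ((continuous_finsetSum _ (hcont k hk)).intervalIntegrable _ _)
      (continuous_const.intervalIntegrable _ _) fun x _ => ?_) h1
    have hc : ∀ k i, |nodeWave J B T x k i| ≤ 1 := fun k i => abs_signWave_le_one _ _ _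
    have hsum := sum_treeMass (nodeWave J B T x) k
    refine le_of_le_of_eq (Finset.sum_le_sum fun i hi => ?_) hsum
    have h0 := treeMass_nonneg hc k i
    have hle : treeMass (nodeWave J B T x) k i ≤ 1 := by
      rw [← hsum]
      exact Finset.single_le_sum (fun j _ => treeMass_nonneg hc k j) hi
    have hw : nodeWave J B T x k i ^ 2 ≤ 1 := (sq_le_one_iff_abs_le_one _).2 (hc k i)
    rw [Complex.norm_real, Real.norm_eq_abs, sq_abs, nodeBlock, mul_pow]
    calc _ ≤ treeMass (nodeWave J B T x) k i ^ 2 * 1 :=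
          mul_le_mul_of_nonneg_left hw (sq_nonneg _)
      _ ≤ _ := by nlinarith
  refine le_trans (Finset.sum_le_sum hlevel) ?_
  simp

/-- Away from few sampling points, all the waves of the tree are close to signs. -/
theorem le_abs_nodeWave {K B T k i : ℕ} {x : ℝ}
    (h : ¬ ∃ m : ℤ, |((4 * nodeFreq B T k i : ℕ) : ℝ) * x - √2 - m| < ((1 / 2) ^ (K + 3)) ^ 2) :
    1 - (1 / 2) ^ (K + 3) ≤ |nodeWave (9 * K + 27) B T x k i| := by
  push Not at h
  -- The cosine is at least 2^(-2(K+3)), whence p = 2(K + 3); the target precision 2^(-(K+3)) gives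
  -- q = K + 3.
  rw [nodeWave, signWave, show 9 * K + 27 = 3 * (K + 3) + 3 * ((K + 3) * 2) by ring]
  refine one_sub_le_abs_signStep_iterate (Real.abs_cos_le_one _) ?_
  rw [pow_mul]
  refine le_trans ?_ (abs_sub_round_le_abs_cos _)
  simpa using h (round (4 * (nodeFreq B T k i : ℝ) * x - √2))

theorem exists_rearrangement {K B T W N : ℕ}
    (hT : 2 * 2 ^ K * 3 ^ (9 * K + 27) < T) (hW : (T + 2 ^ K) * 3 ^ (9 * K + 27) ≤ W)
    (hB : 1 + 3 * W ≤ B) (hN : 2 * B ^ K + 1 ≤ N) :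
    ∃ (σ : Equiv.Perm (Fin N)) (c : Fin N → ℂ), ∑ n, ‖c n‖ ^ 2 ≤ K ∧
      ∀ M : ℕ, 1 ≤ M → ∃ A ⊆ Finset.Icc 1 M, (M : ℝ) / 2 ≤ A.card ∧
        ∀ a ∈ A, (K : ℝ) / 5 ≤ rearrangedMax σ c ((a : ℝ) / M) := by
  classical
  set J := 9 * K + 27 with hJ
  set s : Finset (Σ _ : ℕ, ℕ) := (Finset.range K).sigma fun k => Finset.range (2 ^ k) with hs
  have hmem : ∀ a ∈ s, a.1 < K ∧ a.2 < 2 ^ a.1 ∧ a.2 < 2 ^ K := by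
    intro a ha
    have h := Finset.mem_sigma.1 ha
    have h1 := Finset.mem_range.1 h.1
    have h2 := Finset.mem_range.1 h.2
    exact ⟨h1, h2, h2.trans_le (Nat.pow_le_pow_right two_pos h1.le)⟩
  obtain ⟨σ, c, hc, hmax⟩ := exists_perm_of_disjoint_spectra s
    (fun a x => (nodeBlock J B T a.1 a.2 x : ℂ)) (fun a => nodeSpec J B T a.1 a.2)
    (fun a => (2 * a.2 + 1) * 2 ^ (K - 1 - a.1)) hN
    (fun a ha => nodeBlock_mem_trigSpan hW hB _ _ (hmem a ha).1.le (hmem a ha).2.1)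
    (fun a ha z hz => by
      refine (abs_mem_nodeSpec (by omega) hW hB (hmem a ha).2.2 hz).2.trans ?_
      push_cast
      exact pow_le_pow_right₀ (by exact_mod_cast (by omega : 1 ≤ B)) (hmem a ha).1)
    (fun a ha b hb z hza hzb => by
      obtain ⟨h1, h2⟩ := nodeSpec_disjoint hT hW hB (hmem a ha).2.2 (hmem b hb).2.2 hza hzb
      exact Sigma.ext h1 (heq_of_eq h2))
  refine ⟨σ, c, ?_, fun M hM => ?_⟩
  · rw [hc, hs, Finset.sum_sigma]
    exact sum_integral_nodeBlock_le hW hB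
  -- Each node spoils a proportion at most 4η = 2^(-K-1) of the points, so the at most 2^K nodes
  -- spoil at most half; η also serves as the precision ε, with Kη ≤ 1/8.
  set η : ℝ := (1 / 2) ^ (K + 3) with hη
  have hη0 : 0 < η := by positivity
  have hη1 : η ≤ 1 := pow_le_one₀ (by norm_num) (by norm_num)
  have hηK : 2 ^ K * η = 1 / 8 := by
    rw [hη, pow_add, ← mul_assoc, ← mul_pow]
    norm_num
  set bad : (Σ _ : ℕ, ℕ) → Finset ℕ := fun b => (Finset.Icc 1 M).filter fun a : ℕ =>
    ∃ m : ℤ, |((4 * nodeFreq B T b.1 b.2 : ℕ) : ℝ) * a / M - √2 - m| < η ^ 2 with hbad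
  have hscard : s.card ≤ 2 ^ K := by
    rw [hs, Finset.card_sigma]
    simp only [Finset.card_range]
    exact (Nat.geomSum_lt le_rfl fun k hk => Finset.mem_range.1 hk).le
  have hcard : ((s.biUnion bad).card : ℝ) ≤ M / 2 := by
    calc ((s.biUnion bad).card : ℝ) ≤ ∑ b ∈ s, ((bad b).card : ℝ) := by
          exact_mod_cast Finset.card_biUnion_le
      _ ≤ ∑ b ∈ s, 4 * η * M := Finset.sum_le_sum fun b _ => by
          convert card_near_sqrt_two_le (4 * nodeFreq B T b.1 b.2) M hM hη0 hη1
      _ = s.card * (4 * η * M) := by rw [Finset.sum_const, nsmul_eq_mul]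
      _ ≤ 2 ^ K * (4 * η * M) :=
          mul_le_mul_of_nonneg_right (by exact_mod_cast hscard) (by positivity)
      _ = M / 2 := by linear_combination 4 * (M : ℝ) * hηK
  refine ⟨Finset.Icc 1 M \ s.biUnion bad, Finset.sdiff_subset, ?_, fun a ha => ?_⟩
  · have h1 := Finset.le_card_sdiff (s.biUnion bad) (Finset.Icc 1 M)
    rw [Nat.card_Icc, Nat.add_sub_cancel] at h1
    have h2 : (M : ℝ) ≤ (Finset.Icc 1 M \ s.biUnion bad).card + (s.biUnion bad).card := by
      exact_mod_cast (by omega)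
    linarith
  · obtain ⟨ha1, ha2⟩ := Finset.mem_sdiff.1 ha
    have hK8 : (K : ℝ) * η ≤ 1 / 8 := by
      rw [← hηK]
      exact mul_le_mul_of_nonneg_right (by exact_mod_cast Nat.lt_two_pow_self.le) hη0.le
    obtain ⟨u, hu⟩ := exists_le_inorderSum (c := nodeWave J B T ((a : ℝ) / M)) hη0.le hK8
      (fun k i => abs_signWave_le_one _ _ _) (fun k hk i hi => by
        refine le_abs_nodeWave fun hm => ha2 (Finset.mem_biUnion.2 ⟨⟨k, i⟩,
          Finset.mem_sigma.2 ⟨Finset.mem_range.2 hk, Finset.mem_range.2 hi⟩,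
          Finset.mem_filter.2 ⟨ha1, ?_⟩⟩)
        simpa only [mul_div_assoc] using hm)
    refine hu.trans (le_of_eq_of_le ?_ (hmax _ u))
    rw [← Real.norm_eq_abs, ← Complex.norm_real, Finset.sum_filter, hs, Finset.sum_sigma,
      inorderSum]
    congr 1
    push_cast
    refine Finset.sum_congr rfl fun k _ => Finset.sum_congr rfl fun i _ => ?_
    split_ifs <;> simp [nodeBlock]

/-! ### Choice of parameters -/

/-- Takes T = 2^(76K), W = 2^(149K), B = 2^(151K), then normalises: the energy is at most K, so K/5
becomes at least √K/5. -/
theorem exists_rearrangement_of_le {K N : ℕ} (hK : 0 < K) (hN : 2 ^ (153 * K ^ 2) ≤ N) :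
    ∃ (σ : Equiv.Perm (Fin N)) (b : Fin N → ℂ), ∑ n, ‖b n‖ ^ 2 = 1 ∧
      ∀ M : ℕ, 1 ≤ M → ∃ A ⊆ Finset.Icc 1 M, (M : ℝ) / 2 ≤ A.card ∧
        ∀ a ∈ A, √K / 5 ≤ rearrangedMax σ b ((a : ℝ) / M) := by
  have h3 : 3 ^ (9 * K + 27) ≤ 2 ^ (72 * K) :=
    calc 3 ^ (9 * K + 27) ≤ 4 ^ (36 * K) :=
          (Nat.pow_le_pow_left (by norm_num) _).trans (Nat.pow_le_pow_right (by norm_num) (by omega))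
      _ = 2 ^ (72 * K) := by rw [show (4 : ℕ) = 2 ^ 2 by norm_num, ← pow_mul]; congr 1; ring
  have hT : 2 * 2 ^ K * 3 ^ (9 * K + 27) < 2 ^ (76 * K) :=
    calc 2 * 2 ^ K * 3 ^ (9 * K + 27) ≤ 2 * 2 ^ K * 2 ^ (72 * K) := Nat.mul_le_mul_left _ h3
      _ = 2 ^ (1 + K + 72 * K) := by rw [pow_add, pow_add, pow_one]
      _ < 2 ^ (76 * K) := Nat.pow_lt_pow_right one_lt_two (by omega)
  have hW : (2 ^ (76 * K) + 2 ^ K) * 3 ^ (9 * K + 27) ≤ 2 ^ (149 * K) := by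
    have h1 : 2 ^ (76 * K) + 2 ^ K ≤ 2 ^ (77 * K) :=
      calc 2 ^ (76 * K) + 2 ^ K ≤ 2 ^ (76 * K) + 2 ^ (76 * K) :=
            Nat.add_le_add_left (Nat.pow_le_pow_right two_pos (by omega)) _
        _ = 2 ^ (76 * K + 1) := by rw [pow_succ]; ring
        _ ≤ 2 ^ (77 * K) := Nat.pow_le_pow_right two_pos (by omega)
    refine (Nat.mul_le_mul h1 h3).trans (le_of_eq ?_)
    rw [← pow_add]
    congr 1
    ring
  have hB : 1 + 3 * 2 ^ (149 * K) ≤ 2 ^ (151 * K) :=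
    calc 1 + 3 * 2 ^ (149 * K) ≤ 2 ^ (149 * K) * 4 := by
          have := Nat.one_le_two_pow (n := 149 * K)
          omega
      _ = 2 ^ (149 * K + 2) := by rw [pow_add]; norm_num
      _ ≤ 2 ^ (151 * K) := Nat.pow_le_pow_right two_pos (by omega)
  have hN' : 2 * (2 ^ (151 * K)) ^ K + 1 ≤ N := by
    refine le_trans ?_ hN
    rw [← pow_mul]
    have hKK : 1 ≤ K ^ 2 := Nat.one_le_pow _ _ hK
    calc 2 * 2 ^ (151 * K * K) + 1 ≤ 2 ^ (151 * K * K) * 4 := by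
          have := Nat.one_le_two_pow (n := 151 * K * K)
          omega
      _ = 2 ^ (151 * K * K + 2) := by rw [pow_add]; norm_num
      _ ≤ 2 ^ (153 * K ^ 2) := Nat.pow_le_pow_right two_pos (by nlinarith)
  obtain ⟨σ, c, hc, hmax⟩ := exists_rearrangement hT hW hB hN'
  have hKR : (0 : ℝ) < K := by exact_mod_cast hK
  set Q := ∑ n, ‖c n‖ ^ 2 with hQ
  -- Zero coefficients would contradict the lower bound already for M = 1.
  have hQ0 : 0 < Q := by
    refine (Finset.sum_nonneg fun n _ => sq_nonneg _).lt_of_ne fun h0 => ?_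
    have hz : c = 0 := by
      funext n
      have := (Finset.sum_eq_zero_iff_of_nonneg fun n _ => sq_nonneg ‖c n‖).1 h0.symm n
        (Finset.mem_univ n)
      simpa using this
    obtain ⟨A, -, hA, hAmax⟩ := hmax 1 le_rfl
    obtain ⟨a, ha⟩ : A.Nonempty := by
      rw [← Finset.card_pos]
      have : (0 : ℝ) < A.card := by norm_num at hA; linarith
      exact_mod_cast this
    have := hAmax a ha
    simp only [hz, rearrangedMax, rearrangedPartialSum, Pi.zero_apply, zero_mul,
      Finset.sum_const_zero, norm_zero, Real.iSup_const_zero] at this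
    linarith
  have hr0 : 0 ≤ (√Q)⁻¹ := by positivity
  refine ⟨σ, fun n => ((√Q)⁻¹ : ℝ) * c n, ?_, fun M hM => ?_⟩
  · simp only [norm_mul, Complex.norm_real, Real.norm_of_nonneg hr0, mul_pow, inv_pow,
      Real.sq_sqrt hQ0.le, ← Finset.mul_sum, ← hQ]
    exact inv_mul_cancel₀ hQ0.ne'
  · obtain ⟨A, hAM, hA, hAmax⟩ := hmax M hM
    refine ⟨A, hAM, hA, fun a ha => ?_⟩
    rw [rearrangedMax_smul σ c _ hr0]
    calc √K / 5 = (√K)⁻¹ * (K / 5) := by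
          have hs := Real.sqrt_pos.2 hKR
          field_simp
          exact Real.sq_sqrt hKR.le
      _ ≤ (√Q)⁻¹ * (K / 5) := mul_le_mul_of_nonneg_right
          (inv_anti₀ (Real.sqrt_pos.2 hQ0) (Real.sqrt_le_sqrt hc)) (by positivity)
      _ ≤ _ := mul_le_mul_of_nonneg_left (hAmax a ha) hr0

theorem one_le_rearrangedMax_single {N : ℕ} (n₀ : Fin N) (x : ℝ) :
    1 ≤ rearrangedMax (Equiv.refl _) (Pi.single n₀ 1) x := by
  refine le_trans (le_of_eq ?_) (norm_rearrangedPartialSum_le (Equiv.refl _) _ x n₀)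
  rw [rearrangedPartialSum, Finset.sum_eq_single n₀]
  · simp [norm_addExp]
  · intro n _ hn
    simp [Pi.single_eq_of_ne hn]
  · simp

theorem rpow_quarter_le {y z : ℝ} (hy : 0 ≤ y) (hz : 0 ≤ z) (h : y ≤ z ^ 4) :
    y ^ ((1 : ℝ) / 4) ≤ z := by
  calc y ^ ((1 : ℝ) / 4) ≤ (z ^ 4) ^ ((1 : ℝ) / 4) := Real.rpow_le_rpow hy h (by norm_num)
    _ = z := by
      rw [← Real.rpow_natCast, ← Real.rpow_mul hz]
      norm_num

theorem log_le_natLog_two_add_one (N : ℕ) : Real.log N ≤ Nat.log 2 N + 1 := by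
  rcases N.eq_zero_or_pos with rfl | hN
  · simp
  have h1 : (N : ℝ) ≤ 2 ^ (Nat.log 2 N + 1) := by
    exact_mod_cast (Nat.lt_pow_succ_log_self one_lt_two N).le
  refine (Real.log_le_log (by exact_mod_cast hN) h1).trans ?_
  rw [Real.log_pow]
  push_cast
  have := Real.log_two_lt_d9
  nlinarith [(Nat.cast_nonneg (Nat.log 2 N) : (0 : ℝ) ≤ _)]

theorem le_ncard_of_subset {M : ℕ} {A : Finset ℕ} {P : ℕ → Prop} (hA : A ⊆ Finset.Icc 1 M)
    (hP : ∀ a ∈ A, P a) : A.card ≤ Set.ncard {a : ℕ | a ∈ Finset.Icc 1 M ∧ P a} := by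
  rw [← Set.ncard_coe_finset]
  exact Set.ncard_le_ncard (fun a ha => ⟨hA ha, hP a ha⟩)
    ((Finset.Icc 1 M).finite_toSet.subset fun a ha => ha.1)

end

theorem mainTheorem3 :
    ∃ c₁ c₂ : ℝ, 0 < c₁ ∧ 0 < c₂ ∧
      ∀ N : ℕ, 1 ≤ N →
        ∃ (σ : Equiv.Perm (Fin N)) (b : Fin N → ℂ),
          ∑ n, ‖b n‖ ^ 2 = 1 ∧
          ∀ M : ℕ, 1 ≤ M →
            c₂ * (M : ℝ) ≤
              (Set.ncard {a : ℕ | a ∈ Finset.Icc 1 M ∧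
                c₁ * Real.log (N : ℝ) ^ ((1 : ℝ) / 4) <
                  rearrangedMax σ b ((a : ℝ) / (M : ℝ))} : ℝ) := by
  -- For large N, (log N)^(1/4) ≤ 5√K, and 5/30 < 1/5. For small N, (log N)^(1/4) ≤ 4, and 4/30 < 1
  -- is beaten by a single exponential.
  refine ⟨1 / 30, 1 / 2, by norm_num, by norm_num, fun N hN => ?_⟩
  have hlog0 : 0 ≤ Real.log N := Real.log_natCast_nonneg N
  have hlog := log_le_natLog_two_add_one N
  rcases lt_or_ge (Nat.log 2 N) 153 with hsmall | hlarge
  · have hl : Real.log N ≤ 4 ^ 4 := by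
      have : (Nat.log 2 N : ℝ) < 153 := by exact_mod_cast hsmall
      linarith
    have hq := rpow_quarter_le hlog0 (by norm_num) hl
    refine ⟨Equiv.refl _, Pi.single ⟨0, hN⟩ 1, ?_, fun M hM => ?_⟩
    · rw [Finset.sum_eq_single_of_mem ⟨0, hN⟩ (Finset.mem_univ _)]
      · simp
      · intro n _ hn
        simp [Pi.single_eq_of_ne hn]
    · have h := le_ncard_of_subset (M := M) (A := Finset.Icc 1 M) (P := fun a =>
        1 / 30 * Real.log (N : ℝ) ^ ((1 : ℝ) / 4) < rearrangedMax (Equiv.refl _)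
          (Pi.single (⟨0, hN⟩ : Fin N) 1) ((a : ℝ) / (M : ℝ))) subset_rfl fun a _ => by
            have := one_le_rearrangedMax_single (⟨0, hN⟩ : Fin N) ((a : ℝ) / M)
            linarith
      rw [Nat.card_Icc, Nat.add_sub_cancel] at h
      have h' := (Nat.cast_le (α := ℝ)).2 h
      have : (0 : ℝ) ≤ M := Nat.cast_nonneg M
      linarith
  · set K := Nat.sqrt (Nat.log 2 N / 153) with hKdef
    have hK : 0 < K := Nat.sqrt_pos.2 (Nat.div_pos hlarge (by norm_num))
    have hKN : 2 ^ (153 * K ^ 2) ≤ N := by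
      refine (Nat.pow_le_pow_right two_pos ?_).trans (Nat.pow_log_le_self 2 (by omega))
      have : K ^ 2 ≤ Nat.log 2 N / 153 := Nat.sqrt_le' _
      omega
    -- Here 153 · (K + 1)² ≤ 612 K², rounded up to 625 = 5⁴ for the fourth root.
    have hup : Nat.log 2 N + 1 ≤ 625 * K ^ 2 := by
      have h1 : Nat.log 2 N / 153 < (K + 1) ^ 2 := Nat.lt_succ_sqrt' _
      have h2 : (K + 1) ^ 2 ≤ 4 * K ^ 2 := by nlinarith
      have h3 : 1 ≤ K ^ 2 := Nat.one_le_pow _ _ hK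
      omega
    have hKR : (0 : ℝ) < K := by exact_mod_cast hK
    have hq : Real.log N ^ ((1 : ℝ) / 4) ≤ 5 * √K := by
      refine rpow_quarter_le hlog0 (by positivity) (hlog.trans ?_)
      have h1 : (5 * √K) ^ 4 = 625 * (K : ℝ) ^ 2 := by
        rw [mul_pow, show √(K : ℝ) ^ 4 = (√(K : ℝ) ^ 2) ^ 2 by ring, Real.sq_sqrt hKR.le]
        norm_num
      rw [h1]
      exact_mod_cast hup
    obtain ⟨σ, b, hb, hmax⟩ := exists_rearrangement_of_le hK hKN
    refine ⟨σ, b, hb, fun M hM => ?_⟩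
    obtain ⟨A, hAM, hA, hAmax⟩ := hmax M hM
    have h := (Nat.cast_le (α := ℝ)).2 (le_ncard_of_subset (P := fun a =>
      1 / 30 * Real.log (N : ℝ) ^ ((1 : ℝ) / 4) < rearrangedMax σ b ((a : ℝ) / (M : ℝ))) hAM
      fun a ha => by
        have := hAmax a ha
        have := Real.sqrt_pos.2 hKR
        linarith)
    linarith
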